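/- All rings are associative with unit, and modules are left modules. A Grothendieck abelian category is called \emph{locally noetherian} if it has a generating set of noetherian objects, where an object is noetherian if every ascending chain of its subobjects stabilises. For a ring $A$ let $\mathcal{P}(A)$ denote the category of free $A$-modules of finite rank with all $A$-linear maps, and for an abelian category $\mathcal{A}$ let $\mathrm{Fun}(\mathcal{P}(A)^{\mathrm{op}},\mathcal{A})$ denote the category of all functors $\mathcal{P}(A)^{\mathrm{op}}\to\mathcal{A}$ (not necessarily additive), with natural transformations as morphisms. \textbf{Theorem.} Let $A$ be a finite ring (that is, a ring whose underlying set is finite) and let $\mathcal{A}$ be a locally noetherian Grothendieck abelian category. Then $\mathrm{Fun}(\mathcal{P}(A)^{\mathrm{op}},\mathcal{A})$ is a locally noetherian Grothendieck abelian category. In particular (the artinian conjecture), if $K$ is a finite field, then $\mathrm{Fun}(\mathcal{P}(K)^{\mathrm{op}},\mathrm{Mod}\,K)$ is locally noetherian, where $\mathrm{Mod}\,K$ is the category of all $K$-modules. -/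

import Mathlib

open CategoryTheory

universe w v u u'

/-- A Grothendieck abelian category is *locally noetherian* if it has a generating set
consisting of noetherian objects. As in `IsGrothendieckAbelian.{w}`, the universe `w` says
which families count as sets; for the usual notion, `w` is the universe of the hom-sets. -/
class IsLocallyNoetherianCategory (C : Type u) [Category.{v} C] [Abelian C] : Prop
    extends IsGrothendieckAbelian.{w} C where
  exists_noetherian_generators :
    ∃ (ι : Type w) (G : ι → C),
      (ObjectProperty.ofObj G).IsSeparating ∧ ∀ i, IsNoetherianObject (G i)

/-- The category of free (left) `A`-modules of finite rank, with all `A`-linear maps, as a full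
subcategory of the category of `A`-modules. -/
abbrev FreeModuleCat (A : Type u) [Ring A] : Type (u + 1) :=
  ObjectProperty.FullSubcategory
    (fun M : ModuleCat.{u} A => Module.Free A M ∧ Module.Finite A M)

open Limits

universe v₁ u₁

/-! ### Leading subobjects in finite copowers -/

namespace LeadingTerm

variable {D : Type u'} [Category.{v} D] [Abelian D]

section

variable {J : Type u} [Finite J] [LinearOrder J] {G : D}

/-! This is a Gröbner basis argument. The functor category is generated by the functors W ↦
∐_{Hom(W, V)} G with G a noetherian generator, so it suffices that these are noetherian. At W = Aⁿ
the index set consists of the words of length n in the finite alphabet V, ordered lexicographically.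
A subfunctor then assigns to each word a leading subobject of G, and nested subfunctors with equal
leading subobjects coincide (`isIso_of_leading_le`).

Pulling words back along surjections whose fibre minima increase preserves the strict lexicographic
order, so leading subobjects grow along such pullbacks (`leading_le_leading_map`). By Higman's lemma
words are well-quasi-ordered by them (`wellQuasiOrdered_word`). As G is noetherian, a strictly
increasing chain of subfunctors is impossible (`exists_le_of_wellQuasiOrdered`). -/

lemma eq_zero_of_forall_comp_sigmaπ {X : D} (x : X ⟶ ∐ fun _ : J => G)
    (hx : ∀ a, x ≫ Sigma.π _ a = 0) : x = 0 := by
  have := Fintype.ofFinite J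
  have h : 𝟙 (∐ fun _ : J => G) = ∑ a, Sigma.π _ a ≫ Sigma.ι (fun _ : J => G) a := by
    refine Sigma.hom_ext _ _ fun b => ?_
    rw [Preadditive.comp_sum, Finset.sum_eq_single b]
    · simp
    · intro a _ hab
      rw [Sigma.ι_π_of_ne_assoc _ hab.symm, zero_comp]
    · simp
  rw [← Category.comp_id x, h, Preadditive.comp_sum]
  exact Finset.sum_eq_zero fun a _ => by rw [← Category.assoc, hx, zero_comp]

variable {F F' : D} (j : F ⟶ ∐ fun _ : J => G) (j' : F' ⟶ ∐ fun _ : J => G)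

/-- The endomorphism of a copower which kills the summands of index at most `a`. -/
noncomputable def truncation (G : D) (a : J) : (∐ fun _ : J => G) ⟶ ∐ fun _ : J => G :=
  Sigma.desc fun b => if a < b then Sigma.ι (fun _ : J => G) b else 0

lemma truncation_comp_π_of_lt {a b : J} (h : a < b) :
    truncation G a ≫ Sigma.π _ b = Sigma.π _ b := by
  refine Sigma.hom_ext _ _ fun c => ?_
  rw [truncation, Sigma.ι_desc_assoc]
  split_ifs with hc
  · rfl
  · rw [zero_comp, Sigma.ι_π_of_ne]
    rintro rfl
    exact hc h

lemma truncation_comp_π_of_le {a b : J} (h : b ≤ a) :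
    truncation G a ≫ Sigma.π _ b = 0 := by
  refine Sigma.hom_ext _ _ fun c => ?_
  rw [truncation, Sigma.ι_desc_assoc, comp_zero]
  split_ifs with hc
  · rw [Sigma.ι_π_of_ne]
    rintro rfl
    exact absurd hc h.not_gt
  · rw [zero_comp]

lemma comp_truncation_eq_zero_iff {X : D} (x : X ⟶ ∐ fun _ : J => G) (a : J) :
    x ≫ truncation G a = 0 ↔ ∀ b, a < b → x ≫ Sigma.π _ b = 0 := by
  refine ⟨fun h b hb => ?_, fun h => eq_zero_of_forall_comp_sigmaπ _ fun b => ?_⟩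
  · rw [← truncation_comp_π_of_lt hb, reassoc_of% h, zero_comp]
  · rw [Category.assoc]
    rcases lt_or_ge a b with hb | hb
    · rw [truncation_comp_π_of_lt hb, h b hb]
    · rw [truncation_comp_π_of_le hb, comp_zero]

/-- The subobject of `G` of `a`-th coordinates of those elements of `F` whose coordinates of index
greater than `a` vanish. -/
noncomputable def leading (a : J) : Subobject G :=
  imageSubobject (kernel.ι (j ≫ truncation G a) ≫ j ≫ Sigma.π _ a)

lemma leading_factors {a : J} {X : D} (y : X ⟶ F)
    (hy : ∀ b, a < b → y ≫ j ≫ Sigma.π _ b = 0) :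
    (leading j a).Factors (y ≫ j ≫ Sigma.π _ a) := by
  have hy' : y ≫ j ≫ truncation G a = 0 := by
    rw [← Category.assoc, comp_truncation_eq_zero_iff]
    simpa using hy
  have : y ≫ j ≫ Sigma.π _ a =
      (kernel.lift _ y hy' ≫ factorThruImageSubobject _) ≫ (leading j a).arrow := by
    simp [leading]
  rw [this]
  exact Subobject.factors_comp_arrow _

lemma leading_le {a : J} {P : Subobject G}
    (h : ∀ (X : D) (y : X ⟶ F), (∀ b, a < b → y ≫ j ≫ Sigma.π _ b = 0) →
      P.Factors (y ≫ j ≫ Sigma.π _ a)) : leading j a ≤ P := by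
  have h' : P.Factors (kernel.ι (j ≫ truncation G a) ≫ j ≫ Sigma.π _ a) := by
    refine h _ _ fun b hb => ?_
    have := (comp_truncation_eq_zero_iff (kernel.ι (j ≫ truncation G a) ≫ j) a).1
      (by simp) b hb
    simpa using this
  exact imageSubobject_le _ (P.factorThru _ h') (Subobject.factorThru_arrow _ _ _)

/-- A map into an image need not lift to the source, but it does after pulling back the epimorphism
onto the image. -/
lemma exists_of_leading_factors {a : J} {X : D} (z : X ⟶ G) (hz : (leading j a).Factors z) :
    ∃ (X' : D) (e : X' ⟶ X) (_ : Epi e) (y : X' ⟶ F),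
      (∀ b, a < b → y ≫ j ≫ Sigma.π _ b = 0) ∧ y ≫ j ≫ Sigma.π _ a = e ≫ z := by
  let f := kernel.ι (j ≫ truncation G a) ≫ j ≫ Sigma.π _ a
  let q : X ⟶ (imageSubobject f : D) := (leading j a).factorThru z hz
  refine ⟨pullback q (factorThruImageSubobject f), pullback.fst _ _, inferInstance,
    pullback.snd _ _ ≫ kernel.ι _, fun b hb => ?_, ?_⟩
  · have := (comp_truncation_eq_zero_iff (kernel.ι (j ≫ truncation G a) ≫ j) a).1
      (by simp) b hb
    rw [Category.assoc] at this ⊢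
    rw [this, comp_zero]
  · have h1 : q ≫ (imageSubobject f).arrow = z := Subobject.factorThru_arrow _ _ _
    rw [← h1, pullback.condition_assoc, imageSubobject_arrow_comp, Category.assoc]

variable {j j'}

/-- A monomorphism between subobjects of a finite copower which have the same leading subobjects
is an isomorphism. -/
lemma isIso_of_leading_le [Mono j] [Mono j'] (k : F ⟶ F') (hk : k ≫ j' = j)
    (h : ∀ a, leading j' a ≤ leading j a) : IsIso k := by
  have hkm : Mono k := mono_of_mono_fac hk
  have := Fintype.ofFinite J
  -- Division algorithm: cancel the top coordinate of `x` by an element of `F`, and induct on the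
  -- lower set supporting `x`. Vanishing in the cokernel of `k` may be tested after an epimorphism.
  have key : ∀ s : Finset J, IsLowerSet (s : Set J) → ∀ (X : D) (x : X ⟶ F'),
      (∀ b ∉ s, x ≫ j' ≫ Sigma.π _ b = 0) → x ≫ cokernel.π k = 0 := by
    intro s
    induction s using Finset.induction_on_max with
    | empty =>
      intro _ X x hx
      have : x ≫ j' = 0 := eq_zero_of_forall_comp_sigmaπ _ fun b => by
        simpa using hx b (by simp)
      rw [zero_of_comp_mono j' this, zero_comp]
    | insert a s ha ih =>
      intro hs X x hx
      have hgt : ∀ b, a < b → b ∉ insert a s := fun b hb hb' => by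
        rcases Finset.mem_insert.1 hb' with rfl | hb'
        · exact hb.false
        · exact (hb.trans (ha b hb')).false
      have hlow : IsLowerSet (s : Set J) := fun b c hcb hb => by
        have hb' : b ∈ s := hb
        have hc := hs hcb (Finset.mem_coe.2 (Finset.mem_insert_of_mem hb'))
        rcases Finset.mem_insert.1 (Finset.mem_coe.1 hc) with rfl | hc
        · exact absurd (ha b hb') hcb.not_gt
        · exact hc
      obtain ⟨X', e, he, y, hy, hye⟩ := exists_of_leading_factors j (x ≫ j' ≫ Sigma.π _ a)
        (Subobject.factors_of_le _ (h a)
          (leading_factors j' x fun b hb => hx b (hgt b hb)))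
      have hd := ih hlow X' (e ≫ x - y ≫ k) fun b hb => by
        rw [Preadditive.sub_comp, Category.assoc, Category.assoc, reassoc_of% hk]
        rcases lt_trichotomy a b with hab | rfl | hba
        · rw [hx b (hgt b hab), hy b hab, comp_zero, sub_zero]
        · rw [hye, sub_self]
        · exact absurd ((Finset.mem_insert.1 (hs hba.le (by simp))).resolve_left hba.ne) hb
      rw [Preadditive.sub_comp, Category.assoc, Category.assoc, cokernel.condition, comp_zero,
        sub_zero] at hd
      exact zero_of_epi_comp e hd
  have hepi : Epi k := by
    have := key Finset.univ (fun _ _ _ _ => by simp) F' (𝟙 F') (by simp)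
    rw [Category.id_comp] at this
    exact Preadditive.epi_of_cokernel_zero this
  exact isIso_of_mono_of_epi k

/-- Leading subobjects grow with the subobject. -/
lemma leading_mono (k : F ⟶ F') (hk : k ≫ j' = j) (a : J) : leading j a ≤ leading j' a := by
  subst hk
  refine leading_le _ fun X y hy => ?_
  simpa using leading_factors j' (y ≫ k) (a := a) (by simpa using hy)

end

/-- Leading subobjects are transported by strictly monotone reindexing. -/
lemma leading_le_leading_map {J J' : Type u} [Finite J] [LinearOrder J] [Finite J']
    [LinearOrder J'] {G F F' : D} {j : F ⟶ ∐ fun _ : J => G} {j' : F' ⟶ ∐ fun _ : J' => G}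
    (s : J → J') (hs : StrictMono s) (k : F ⟶ F')
    (hk : k ≫ j' = j ≫ Sigma.desc fun a => Sigma.ι (fun _ : J' => G) (s a)) (a : J) :
    leading j a ≤ leading j' (s a) := by
  have hs1 (b : J) : (Sigma.desc fun a => Sigma.ι (fun _ : J' => G) (s a)) ≫ Sigma.π _ (s b) =
      Sigma.π (fun _ : J => G) b := by
    refine Sigma.hom_ext _ _ fun c => ?_
    rw [Sigma.ι_desc_assoc]
    by_cases hcb : c = b
    · subst hcb; simp
    · rw [Sigma.ι_π_of_ne _ hcb, Sigma.ι_π_of_ne _ (hs.injective.ne hcb)]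
  have hs2 (b : J') (hb : b ∉ Set.range s) :
      (Sigma.desc fun a => Sigma.ι (fun _ : J' => G) (s a)) ≫ Sigma.π _ b = 0 := by
    refine Sigma.hom_ext _ _ fun c => ?_
    rw [Sigma.ι_desc_assoc, Sigma.ι_π_of_ne _ (fun h => hb ⟨c, h⟩), comp_zero]
  refine leading_le _ fun X y hy => ?_
  have := leading_factors j' (a := s a) (y ≫ k) fun b hb => by
    rw [Category.assoc, reassoc_of% hk]
    by_cases hbr : b ∈ Set.range s
    · obtain ⟨c, rfl⟩ := hbr
      rw [hs1, hy c (hs.lt_iff_lt.1 hb)]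
    · rw [hs2 b hbr, comp_zero, comp_zero]
  rwa [Category.assoc, reassoc_of% hk, hs1] at this

/-- A monotone function from a well-quasi-order to a noetherian order cannot be enlarged
infinitely often. -/
lemma exists_le_of_wellQuasiOrdered {α β : Type*} {r : α → α → Prop} (hr : WellQuasiOrdered r)
    [PartialOrder β] [WellFoundedGT β] (f : ℕ → α → β) (hf : ∀ a, Monotone fun k => f k a)
    (hfr : ∀ k a b, r a b → f k a ≤ f k b) (x : ℕ → α) :
    ∃ k, f (k + 1) (x k) ≤ f k (x k) := by
  by_contra! hx
  -- Unlike `r`, this coarser relation is transitive by construction, so monotone subsequences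
  -- exist.
  let r' : α → α → Prop := fun a b => ∀ k, f k a ≤ f k b
  have hr' : WellQuasiOrdered r' := fun y =>
    let ⟨m, n, hmn, h⟩ := hr y
    ⟨m, n, hmn, fun k => hfr k _ _ h⟩
  have : IsPreorder α r' :=
    { refl := fun _ _ => le_rfl
      trans := fun _ _ _ h h' k => (h k).trans (h' k) }
  obtain ⟨g, hg⟩ := hr'.exists_monotone_subseq x
  refine not_strictMono_of_wellFoundedGT (fun m => f (g m + 1) (x (g m)))
    (strictMono_nat_of_lt_succ fun m => ?_)
  refine lt_of_le_of_lt ?_ (lt_of_le_not_ge (hf _ (Nat.le_succ _)) (hx (g (m + 1))))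
  exact (hf _ (g.strictMono m.lt_succ_self)).trans (hg m (m + 1) m.le_succ _)

/-! ### Noetherian objects and generators in functor categories -/

variable {C : Type u₁} [Category.{v₁} C]

/-- The functor freely generated at `c` by a noetherian object is noetherian, provided that the
morphisms out of `c` carry linear orders for which they are well-quasi-ordered by strictly monotone
postcomposition. -/
theorem isNoetherianObject_evaluationLeftAdjoint [∀ a b : C, Finite (a ⟶ b)] (c : C)
    {I : Type*} (t : I → C)
    (ht : ∀ x : C, ∃ i, Nonempty (t i ≅ x)) [∀ i, LinearOrder (c ⟶ t i)]
    (hwqo : WellQuasiOrdered fun p q : Σ i, (c ⟶ t i) =>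
      ∃ φ : t p.1 ⟶ t q.1, p.2 ≫ φ = q.2 ∧ StrictMono fun g : c ⟶ t p.1 => g ≫ φ)
    (G : D) [IsNoetherianObject G] :
    IsNoetherianObject ((evaluationLeftAdjoint D c).obj G) := by
  rw [isNoetherianObject_iff_not_strictMono]
  intro P hP
  let lead (k : ℕ) (p : Σ i, (c ⟶ t i)) : Subobject G :=
    leading (J := c ⟶ t p.1) ((P k).arrow.app (t p.1)) p.2
  have hcomm (k : ℕ) (x : C) : (Subobject.ofLE _ _ (hP k.lt_succ_self).le).app x ≫
      (P (k + 1)).arrow.app x = (P k).arrow.app x := by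
    rw [← NatTrans.comp_app, Subobject.ofLE_arrow]
  have hmono (k : ℕ) (i : I) :
      Mono (Y := ∐ fun _ : c ⟶ t i => G) ((P k).arrow.app (t i)) :=
    inferInstanceAs (Mono ((P k).arrow.app (t i)))
  -- Each strict step of the chain must enlarge some leading subobject; otherwise the inclusion is
  -- invertible at every `t i`, hence everywhere.
  have hex (k : ℕ) : ∃ p, ¬ lead (k + 1) p ≤ lead k p := by
    by_contra! h
    have hle := (hP k.lt_succ_self).le
    have hiso (i : I) : IsIso ((Subobject.ofLE _ _ hle).app (t i)) :=
      isIso_of_leading_le (J := c ⟶ t i) (j := (P k).arrow.app (t i))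
        (j' := (P (k + 1)).arrow.app (t i)) _
        (hcomm k (t i)) (fun a => h ⟨i, a⟩)
    have hiso' (x : C) : IsIso ((Subobject.ofLE _ _ hle).app x) := by
      obtain ⟨i, ⟨e⟩⟩ := ht x
      have := hiso i
      rw [show (Subobject.ofLE _ _ hle).app x = (P k : C ⥤ D).map e.inv ≫
        (Subobject.ofLE _ _ hle).app (t i) ≫ (P (k + 1) : C ⥤ D).map e.hom by
          rw [← NatTrans.naturality, ← Functor.map_comp_assoc]; simp]
      infer_instance
    have : IsIso (Subobject.ofLE _ _ hle) := NatIso.isIso_of_isIso_app _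
    exact (hP k.lt_succ_self).not_ge
      (Subobject.le_of_comm (inv (Subobject.ofLE _ _ hle)) (by simp))
  choose p hp using hex
  obtain ⟨k, hk⟩ := exists_le_of_wellQuasiOrdered hwqo lead
    (fun a => monotone_nat_of_le_succ fun k =>
      leading_mono (J := c ⟶ t a.1) ((Subobject.ofLE _ _ (hP k.lt_succ_self).le).app (t a.1))
        (hcomm k (t a.1)) a.2)
    (fun k => by
      rintro ⟨i, a⟩ ⟨i', a'⟩ ⟨φ, h, hφ⟩
      dsimp only at φ h hφ
      subst h
      exact leading_le_leading_map (J := c ⟶ t i) (J' := c ⟶ t i') (fun g => g ≫ φ) hφ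
        ((P k : C ⥤ D).map φ) ((P k).arrow.naturality φ) a)
    p
  exact hp k hk

/-- Free functors on a separating family, at representatives of all isomorphism classes,
form a separating family. -/
lemma isSeparating_evaluationLeftAdjoint [∀ a b : C, Finite (a ⟶ b)] {I : Type*} (t : I → C)
    (ht : ∀ x : C, ∃ i, Nonempty (t i ≅ x)) {κ : Type*} {G : κ → D}
    (hG : (ObjectProperty.ofObj G).IsSeparating) {ι : Type*} (i : ι → I) (g : ι → κ)
    (hig : ∀ a b, ∃ x, i x = a ∧ g x = b) :
    (ObjectProperty.ofObj
      fun x => (evaluationLeftAdjoint D (t (i x))).obj (G (g x))).IsSeparating := by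
  intro X Y f f' h
  have h1 (a : I) : f.app (t a) = f'.app (t a) := by
    refine hG _ _ ?_
    rintro _ ⟨b⟩ α
    obtain ⟨x, rfl, rfl⟩ := hig a b
    have := h _ (ObjectProperty.ofObj_apply _ x)
      (((evaluationAdjunctionRight D (t (i x))).homEquiv _ _).symm α)
    rw [← Adjunction.homEquiv_naturality_right_symm, ← Adjunction.homEquiv_naturality_right_symm]
      at this
    exact (Equiv.injective _ this)
  ext x
  obtain ⟨a, ⟨e⟩⟩ := ht x
  rw [← cancel_epi (X.map e.hom), f.naturality, f'.naturality, h1]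

/-- Functors from an essentially small category to a Grothendieck abelian category form a
Grothendieck abelian category. -/
lemma isGrothendieckAbelian_functor [EssentiallySmall.{w} C] [IsGrothendieckAbelian.{w} D] :
    IsGrothendieckAbelian.{w} (Cᵒᵖ ⥤ D) := by
  let S := SmallModel.{w} C
  have : IsGrothendieckAbelian.{w} (Sᵒᵖ ⥤ D) :=
    { ab5OfSize := ⟨fun _ _ _ => inferInstance⟩ }
  exact .of_equivalence (equivSmallModel C).op.symm.congrLeft

end LeadingTerm

/-! ### Combinatorics of words -/

open Opposite

/-- Surjections for which the minima of the fibres increase; `f` sends an element to the minimum of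
its fibre. -/
def IsOrderedSurjection {n m : ℕ} (φ : Fin m → Fin n) : Prop :=
  ∃ f : Fin n → Fin m, StrictMono f ∧ (∀ i, φ (f i) = i) ∧ ∀ j, f (φ j) ≤ j

/-- If the words first differ at `i`, their pullbacks first differ at the minimum of the fibre over
`i`. -/
lemma IsOrderedSurjection.toLex_comp_lt {α : Type*} [LinearOrder α] {n m : ℕ}
    {φ : Fin m → Fin n} (hφ : IsOrderedSurjection φ) {a b : Fin n → α}
    (h : toLex a < toLex b) : toLex (a ∘ φ) < toLex (b ∘ φ) := by
  obtain ⟨f, hf, hφf, hfφ⟩ := hφ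
  obtain ⟨i, hi, hlt⟩ := h
  refine ⟨f i, fun j hj => hi _ ?_, ?_⟩
  · exact hf.lt_iff_lt.1 ((hfφ j).trans_lt hj)
  · simpa [hφf] using hlt

open Classical in
/-- A word, with each letter marked according to whether it occurs for the first time. -/
noncomputable def markedWord {α : Type*} {n : ℕ} (a : Fin n → α) : List (α × Bool) :=
  List.ofFn fun j => (a j, decide (∀ i < j, a i ≠ a j))

/-- The marks force the embedding to send first occurrences to first occurrences. A position outside
its image can thus be sent to the first occurrence of its letter in `a`, without lowering any fibre
minimum. -/
lemma exists_isOrderedSurjection_of_sublist {α : Type*} {n m : ℕ} {a : Fin n → α}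
    {b : Fin m → α} (h : (markedWord a).Sublist (markedWord b)) (hab : Set.range a = Set.range b) :
    ∃ φ : Fin m → Fin n, IsOrderedSurjection φ ∧ a ∘ φ = b := by
  classical
  obtain ⟨g, hg⟩ := List.sublist_iff_exists_fin_orderEmbedding_get_eq.1 h
  obtain ⟨f, hf, hfa, hfirst⟩ : ∃ f : Fin n → Fin m, StrictMono f ∧ (∀ i, a i = b (f i)) ∧
      ∀ i, (∀ k < i, a k ≠ a i) → ∀ k < f i, b k ≠ b (f i) := by
    have hn : n = (markedWord a).length := by simp [markedWord]
    have hm : (markedWord b).length = m := by simp [markedWord]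
    refine ⟨fun i => Fin.cast hm (g (Fin.cast hn i)), fun i k hik => ?_, ?_⟩
    · exact g.strictMono (show Fin.cast hn i < Fin.cast hn k from hik)
    · rw [← forall_and]
      intro i
      have := hg (Fin.cast hn i)
      simp only [markedWord, List.get_ofFn, Prod.mk.injEq, decide_eq_decide] at this
      exact ⟨this.1, fun hi => this.2.1 hi⟩
  have hex (j : Fin m) : ∃ i, f i ≤ j ∧ a i = b j := by
    have hj : ∃ i, a i = b j := by
      rw [← Set.mem_range, hab]
      exact ⟨j, rfl⟩
    obtain ⟨i, hi, hmin⟩ := WellFounded.has_min (wellFounded_lt (α := Fin n))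
      {i | a i = b j} hj
    refine ⟨i, not_lt.1 fun hji => ?_, hi⟩
    refine hfirst i (fun k hk hki => hmin k (hki.trans hi) hk) j hji ?_
    rw [← hfa, ← hi]
  choose φ hφ hφa using hex
  refine ⟨fun j => if hj : ∃ i, f i = j then hj.choose else φ j, ⟨f, hf, fun i => ?_, fun j => ?_⟩,
    funext fun j => ?_⟩
  · have hi : ∃ i', f i' = f i := ⟨i, rfl⟩
    beta_reduce
    rw [dif_pos hi]
    exact hf.injective hi.choose_spec
  · beta_reduce
    split_ifs with hj
    · exact hj.choose_spec.le
    · exact hφ j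
  · simp only [Function.comp_apply]
    split_ifs with hj
    · rw [hfa, hj.choose_spec]
    · exact hφa j

/-- Words in a finite alphabet are well-quasi-ordered by pullback along ordered surjections. -/
lemma wellQuasiOrdered_word (α : Type*) [Finite α] :
    WellQuasiOrdered fun p q : Σ n, (Fin n → α) =>
      ∃ φ : Fin q.1 → Fin p.1, IsOrderedSurjection φ ∧ p.2 ∘ φ = q.2 := by
  -- Higman's lemma for the alphabet of marked letters.
  have h1 : WellQuasiOrdered (List.SublistForall₂ (α := α × Bool) (· = ·)) := by
    rw [← Set.partiallyWellOrderedOn_univ_iff]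
    simpa using Set.PartiallyWellOrderedOn.partiallyWellOrderedOn_sublistForall₂ (· = ·)
      (Set.partiallyWellOrderedOn_univ_iff.2 (Finite.wellQuasiOrdered (α := α × Bool) (· = ·)))
  have h2 : WellQuasiOrdered (α := Set α) (· = ·) := Finite.wellQuasiOrdered _
  have : IsPreorder (List (α × Bool)) (List.SublistForall₂ (· = ·)) := { }
  intro p
  obtain ⟨m, n, hmn, h⟩ := h1.prod h2 fun k => (markedWord (p k).2, Set.range (p k).2)
  refine ⟨m, n, hmn, exists_isOrderedSurjection_of_sublist ?_ h.2⟩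
  obtain ⟨l, hl, hs⟩ := List.sublistForall₂_iff.1 h.1
  rw [List.forall₂_eq_eq_eq] at hl
  subst hl
  exact hs

/-! ### Free modules over a finite ring -/

variable (A : Type u) [Ring A]

/-- The free module `Aⁿ`. -/
def FreeModuleCat.pow (n : ℕ) : FreeModuleCat A :=
  ⟨ModuleCat.of A (Fin n → A), inferInstanceAs (Module.Free A (Fin n → A)),
    inferInstanceAs (Module.Finite A (Fin n → A))⟩

namespace FreeModuleCat

variable {A}

lemma finite_of_finite [Finite A] (V : FreeModuleCat A) : Finite V.obj :=
  have := V.property.2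
  Module.finite_of_finite A

instance [Finite A] (V W : FreeModuleCat A) : Finite (V ⟶ W) := by
  have := finite_of_finite V
  have := finite_of_finite W
  refine Finite.of_injective (fun (f : V ⟶ W) (x : V.obj) => f.hom.hom x) fun f g h => ?_
  ext x
  exact congr_fun h x

lemma exists_iso_pow [Finite A] (V : FreeModuleCat A) : ∃ n, Nonempty (pow A n ≅ V) := by
  have := V.property.1
  have := V.property.2
  suffices ∃ n, Nonempty ((Fin n → A) ≃ₗ[A] V.obj) by
    obtain ⟨n, ⟨e⟩⟩ := this
    exact ⟨n, ⟨ObjectProperty.isoMk _ e.toModuleIso⟩⟩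
  -- Over the zero ring a basis may be infinite, but every module is zero.
  rcases subsingleton_or_nontrivial A with h | h
  · have : Subsingleton V.obj := Module.subsingleton A _
    exact ⟨0, ⟨0⟩⟩
  · let b := Module.Free.chooseBasis A V.obj
    have := Module.Finite.finite_basis b
    obtain ⟨n, ⟨e⟩⟩ := Finite.exists_equiv_fin (Module.Free.ChooseBasisIndex A V.obj)
    exact ⟨n, ⟨(b.reindex e).equivFun.symm⟩⟩

instance [Finite A] (V W : (FreeModuleCat A)ᵒᵖ) : Finite (V ⟶ W) :=
  Finite.of_equiv _ (opEquiv V W).symm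

lemma exists_iso_op_pow [Finite A] (V : (FreeModuleCat A)ᵒᵖ) :
    ∃ n, Nonempty (op (pow A n) ≅ V) :=
  let ⟨n, ⟨e⟩⟩ := exists_iso_pow V.unop
  ⟨n, ⟨e.symm.op⟩⟩

instance essentiallySmall [Finite A] : EssentiallySmall.{w} (FreeModuleCat A) := by
  refine (essentiallySmall_iff _).2
    ⟨small_of_surjective (f := fun n : ULift.{w} ℕ => toSkeleton (pow A n.down)) fun x => ?_,
      ⟨fun _ _ => inferInstance⟩⟩
  obtain ⟨V, rfl⟩ := Quotient.exists_rep x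
  obtain ⟨n, hn⟩ := exists_iso_pow V
  exact ⟨⟨n⟩, Quotient.sound hn⟩

/-- The images of the standard basis vectors under a linear map from `Aⁿ`. -/
def word {V : FreeModuleCat A} {n : ℕ} (g : op V ⟶ op (pow A n)) (i : Fin n) : V.obj :=
  g.unop.hom.hom (Pi.single i 1 : Fin n → A)

lemma word_injective {V : FreeModuleCat A} {n : ℕ} :
    Function.Injective (word : (op V ⟶ op (pow A n)) → Fin n → V.obj) := by
  intro g g' h
  apply Quiver.Hom.unop_inj
  ext : 2
  refine LinearMap.pi_ext' fun i => LinearMap.ext_ring ?_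
  exact congr_fun h i

/-- The linear map `Aᵐ ⟶ Aⁿ` which acts on standard basis vectors by `φ`. -/
def powMap (A : Type u) [Ring A] {n m : ℕ} (φ : Fin m → Fin n) : op (pow A n) ⟶ op (pow A m) :=
  Quiver.Hom.op (ObjectProperty.homMk (ModuleCat.ofHom
    (Fintype.linearCombination A fun j => (Pi.single (φ j) 1 : Fin n → A))))

lemma word_comp_powMap {V : FreeModuleCat A} {n m : ℕ} (g : op V ⟶ op (pow A n))
    (φ : Fin m → Fin n) : word (g ≫ powMap A φ) = word g ∘ φ := by
  funext j
  change g.unop.hom.hom (Fintype.linearCombination A (fun j => (Pi.single (φ j) 1 : Fin n → A))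
    (Pi.single j 1)) = g.unop.hom.hom (Pi.single (φ j) 1 : Fin n → A)
  rw [Fintype.linearCombination_apply_single, one_smul]

variable {D : Type u'} [Category.{v} D] [Abelian D]

instance isNoetherianObject_evaluationLeftAdjoint [Finite A] (V : FreeModuleCat A) (G : D)
    [IsNoetherianObject G] :
    IsNoetherianObject ((evaluationLeftAdjoint D (op V)).obj G) := by
  have := finite_of_finite V
  -- Any linear order on the letters will do.
  let : LinearOrder V.obj := by
    classical exact linearOrderOfSTO WellOrderingRel
  let (n : ℕ) : LinearOrder (op V ⟶ op (pow A n)) :=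
    LinearOrder.lift' (fun g => toLex (word g)) (toLex.injective.comp word_injective)
  refine LeadingTerm.isNoetherianObject_evaluationLeftAdjoint (op V) (fun n => op (pow A n))
    exists_iso_op_pow ?_ G
  · intro p
    obtain ⟨k, l, hkl, φ, hφ, h⟩ := wellQuasiOrdered_word V.obj fun k => ⟨(p k).1, word (p k).2⟩
    refine ⟨k, l, hkl, powMap A φ, word_injective ?_, fun g g' hgg' => ?_⟩
    · rw [word_comp_powMap, h]
    · change toLex (word (g ≫ powMap A φ)) < toLex (word (g' ≫ powMap A φ))
      rw [word_comp_powMap, word_comp_powMap]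
      exact hφ.toLex_comp_lt hgg'

/-- Functors on free modules of finite rank over a finite ring, with values in a locally noetherian
category, form a locally noetherian category. -/
theorem isLocallyNoetherianCategory_functor [Finite A] [h : IsLocallyNoetherianCategory.{w} D] :
    IsLocallyNoetherianCategory.{w} ((FreeModuleCat A)ᵒᵖ ⥤ D) := by
  obtain ⟨ι, G, hG, hG'⟩ := h.exists_noetherian_generators
  exact
    { toIsGrothendieckAbelian := LeadingTerm.isGrothendieckAbelian_functor
      exists_noetherian_generators :=
        ⟨ℕ × ι, fun x => (evaluationLeftAdjoint D (op (pow A x.1))).obj (G x.2),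
          LeadingTerm.isSeparating_evaluationLeftAdjoint (fun n => op (pow A n))
            exists_iso_op_pow hG Prod.fst Prod.snd fun a b => ⟨(a, b), rfl, rfl⟩,
          fun _ => inferInstance⟩ }

end FreeModuleCat

/-- Modules over a noetherian ring form a locally noetherian category. -/
theorem ModuleCat.isLocallyNoetherianCategory (R : Type u) [Ring R] [IsNoetherianRing R] :
    IsLocallyNoetherianCategory.{u} (ModuleCat.{u} R) where
  exists_noetherian_generators := by
    refine ⟨PUnit, fun _ => ModuleCat.of R R, fun X Y f g h => ?_, fun _ => ?_⟩
    · ext x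
      have := h _ (ObjectProperty.ofObj_apply _ PUnit.unit)
        (ModuleCat.ofHom (LinearMap.toSpanSingleton R X x))
      simpa using congr($(this).hom (1 : R))
    · exact ⟨(ModuleCat.subobjectModule (ModuleCat.of R R)).toOrderEmbedding.wellFoundedGT⟩

theorem mainTheorem1 :
    (∀ (A : Type u) [Ring A] [Finite A] (𝒜 : Type u') [Category.{v} 𝒜] [Abelian 𝒜],
        IsLocallyNoetherianCategory.{w} 𝒜 →
          IsLocallyNoetherianCategory.{w} ((FreeModuleCat A)ᵒᵖ ⥤ 𝒜)) ∧
      (∀ (K : Type u) [Field K] [Finite K],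
        IsLocallyNoetherianCategory.{u} ((FreeModuleCat K)ᵒᵖ ⥤ ModuleCat.{u} K)) := by
  refine ⟨fun A _ _ 𝒜 _ _ _ => FreeModuleCat.isLocallyNoetherianCategory_functor, fun K _ _ => ?_⟩
  have := ModuleCat.isLocallyNoetherianCategory K
  exact FreeModuleCat.isLocallyNoetherianCategory_functor
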